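/- Let $\boldsymbol\nu=(\nu_1,\dots,\nu_n)$ be a random vector with values in $\{0,1\}^n$, let $X_d=(X_{d_1},\dots,X_{d_n})$ be a real random vector whose components are discrete (each takes values in a countable set almost surely), and let $X_c=(X_{c_1},\dots,X_{c_n})$ be a random vector whose joint law is absolutely continuous with respect to Lebesgue measure on $\mathbb{R}^n$ and which is independent of the pair $(\boldsymbol\nu,X_d)$; the joint law of $(\boldsymbol\nu,X_d)$ is otherwise arbitrary. Let $X^n$ be a random vector with the same (joint) distribution as the vector with components $\nu_iX_{c_i}+(1-\nu_i)X_{d_i}$, $1\le i\le n$. Let $H$ denote Shannon entropy and suppose that $H(\boldsymbol\nu,X_d)<\infty$. For a random vector $Y$ in $\mathbb{R}^m$ and an integer $k\ge 1$ write $[Y]_k=\big(\lfloor kY_1\rfloor/k,\dots,\lfloor kY_m\rfloor/k\big)$, and let $$d(Y)=\lim_{k\to\infty}\frac{H([Y]_k)}{\log k}$$ be the Rényi information dimension of $Y$, if this limit exists. Let $A$ be a real $m\times n$ matrix, and suppose that $Y^m=AX^n$ has an integer part of finite entropy, $H([Y^m]_1)<\infty$. Then the Rényi information dimension of $Y^m$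 exists and $$d(Y^m)=\mathbb{E}_{\boldsymbol\nu}\big[\operatorname{rank}(A^{\boldsymbol\nu})\big],$$ where $A^{\boldsymbol\nu}$ is the submatrix of $A$ formed by the columns $i$ with $\nu_i=1$. -/

import Mathlib

open MeasureTheory ProbabilityTheory Filter Topology
open scoped ENNReal Matrix

namespace InfoDim

/-- Shannon entropy (in nats, with value in `[0, ∞]`) of a discrete probability law `P`:
the sum of `-P{x} log P{x}` over all points `x`; only the countably many atoms contribute. -/
noncomputable def shannonEntropy {α : Type*} [MeasurableSpace α] (P : Measure α) : ℝ≥0∞ :=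
  ∑' x : α, ENNReal.ofReal (Real.negMulLog (P.real {x}))

/-- A law is discrete if it is carried by a countable set. -/
def IsDiscreteLaw {α : Type*} [MeasurableSpace α] (P : Measure α) : Prop :=
  ∃ S : Set α, S.Countable ∧ P Sᶜ = 0

/-- Uniform quantization with precision `k`: every coordinate `x i` is replaced by `⌊k x i⌋ / k`. -/
noncomputable def quantize {ι : Type*} (k : ℕ) (x : ι → ℝ) : ι → ℝ :=
  fun i => (⌊(k : ℝ) * x i⌋ : ℝ) / (k : ℝ)

/-- `P`, a law on `ℝ^ι`, has Rényi information dimension `d`: the limit of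
`H([X]_k) / log k` as `k → ∞`, with `X` of law `P`, exists in `[0, ∞]` and equals `d`. -/
def HasRenyiDim {ι : Type*} (P : Measure (ι → ℝ)) (d : ℝ≥0∞) : Prop :=
  Tendsto (fun k : ℕ => shannonEntropy (P.map (quantize k)) / ENNReal.ofReal (Real.log (k : ℝ)))
    atTop (𝓝 d)

/-- The value `0` or `1` of a selection variable, as a real number. -/
def bit (b : Bool) : ℝ := if b = true then 1 else 0

/-- The vector with components `ν_i x_{c,i} + (1 - ν_i) x_{d,i}`. -/
def mix {ι : Type*} (ν : ι → Bool) (xc xd : ι → ℝ) : ι → ℝ :=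
  fun i => bit (ν i) * xc i + (1 - bit (ν i)) * xd i

/-- The submatrix formed by the columns `i` of `A` with `ν_i = 1`. -/
def selectCols {κ ι : Type*} (A : Matrix κ ι ℝ) (ν : ι → Bool) :
    Matrix κ {i : ι // ν i = true} ℝ :=
  A.submatrix id Subtype.val

end InfoDim

namespace InfoDim

/-! Condition on the discrete data `d = (ν, Xd)`, which has countably many values. By independence
`Xc` keeps its absolutely continuous law `Q`, and `A X` becomes an affine image of `Xc` whose linear
part has the rank of the selected columns. So the law of `A X` is a countable mixture, with the
weights of `(ν, Xd)`, of affine images of `Q`.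

The entropy of a quantized mixture lies between the mean entropy of its components (concavity) and
that mean plus the entropy of the weights (`le_quantEntropy_mixture`, `quantEntropy_mixture_le`).
The weights have finite entropy, so this gap vanishes after division by `log k`, and it remains to
see that a component of rank `r` has entropy growing like `r log k`.

Upper bound (`exists_quantEntropy_affine_le`): a rank `r` affine image meets at most `C k ^ r` cells
in each unit cube, so the entropy exceeds that at precision `1` by at most `log C + r log k`. Here
`C` does not depend on the shift, hence one constant serves all components.

Lower bound (`rank_le_liminf_quantEntropy`): projection to `r` independent rows gives an absolutely
continuous law on `ℝ^r`, so all but `ε` of the mass lies in cells of mass `O(k ^ (-r))`. Fatou's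
lemma then carries the bound through the countable mixture. -/

/-! ### Entropy inequalities for countable families of masses. -/

/-- The contribution `-x log x` of an atom of mass `x` to the entropy. -/
noncomputable def pointEntropy (x : ℝ≥0∞) : ℝ≥0∞ := ENNReal.ofReal (Real.negMulLog x.toReal)

/-- The positive part of `-log x`. -/
noncomputable def surprisal (x : ℝ≥0∞) : ℝ≥0∞ := ENNReal.ofReal (-Real.log x.toReal)

@[simp] lemma pointEntropy_zero : pointEntropy 0 = 0 := by simp [pointEntropy]

lemma pointEntropy_eq_mul {x : ℝ≥0∞} (hx : x ≠ ∞) : pointEntropy x = x * surprisal x := by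
  rw [pointEntropy, surprisal, Real.negMulLog, neg_mul, ← mul_neg,
    ENNReal.ofReal_mul ENNReal.toReal_nonneg, ENNReal.ofReal_toReal hx]

lemma surprisal_anti {x y : ℝ≥0∞} (hx : x ≠ 0) (hxy : x ≤ y) (hy : y ≠ ∞) :
    surprisal y ≤ surprisal x := by
  have hx' : x ≠ ∞ := ne_top_of_le_ne_top hy hxy
  refine ENNReal.ofReal_le_ofReal (neg_le_neg (Real.log_le_log ?_ ?_))
  · exact ENNReal.toReal_pos hx hx'
  · exact ENNReal.toReal_mono hy hxy

/-- Each part has at most the total mass, hence at least the surprisal of the total. -/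
lemma pointEntropy_tsum_le {ι : Type*} (a : ι → ℝ≥0∞) (h : ∑' i, a i ≠ ∞) :
    pointEntropy (∑' i, a i) ≤ ∑' i, pointEntropy (a i) := by
  rw [pointEntropy_eq_mul h, ← ENNReal.tsum_mul_right]
  refine ENNReal.tsum_le_tsum fun i => ?_
  have hi : a i ≤ ∑' i, a i := ENNReal.le_tsum i
  rw [pointEntropy_eq_mul (ne_top_of_le_ne_top h hi)]
  rcases eq_or_ne (a i) 0 with h0 | h0
  · simp [h0]
  · exact mul_le_mul_right (surprisal_anti h0 hi h) _

/-- The concave function `-y log y` lies below its tangent at `x`. -/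
lemma pointEntropy_add_le {x y : ℝ≥0∞} (hx0 : x ≠ 0) (hx : x ≤ 1) (hy : y ≤ 1) :
    pointEntropy y + y ≤ y * surprisal x + x := by
  have hx' : x ≠ ∞ := ne_top_of_le_ne_top ENNReal.one_ne_top hx
  have hy' : y ≠ ∞ := ne_top_of_le_ne_top ENNReal.one_ne_top hy
  rcases eq_or_ne y 0 with rfl | hy0
  · simp
  have hxr : 0 < x.toReal := ENNReal.toReal_pos hx0 hx'
  have hyr : 0 < y.toReal := ENNReal.toReal_pos hy0 hy'
  have hx1 : x.toReal ≤ 1 := ENNReal.toReal_le_of_le_ofReal zero_le_one (by simpa using hx)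
  have hy1 : y.toReal ≤ 1 := ENNReal.toReal_le_of_le_ofReal zero_le_one (by simpa using hy)
  have hlx : 0 ≤ -Real.log x.toReal := by
    have := Real.log_nonpos hxr.le hx1
    linarith
  have hly := Real.negMulLog_nonneg hyr.le hy1
  have key : Real.negMulLog y.toReal + y.toReal
      ≤ y.toReal * -Real.log x.toReal + x.toReal := by
    have h := Real.log_le_sub_one_of_pos (div_pos hxr hyr)
    rw [Real.log_div hxr.ne' hyr.ne'] at h
    have h2 := mul_le_mul_of_nonneg_left h hyr.le
    have h3 : y.toReal * (x.toReal / y.toReal - 1) = x.toReal - y.toReal := by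
      field_simp
    rw [h3] at h2
    rw [Real.negMulLog]
    linarith
  have := ENNReal.ofReal_le_ofReal key
  rwa [ENNReal.ofReal_add hly hyr.le, ENNReal.ofReal_add (mul_nonneg hyr.le hlx) hxr.le,
    ENNReal.ofReal_mul hyr.le, ENNReal.ofReal_toReal hx', ENNReal.ofReal_toReal hy'] at this

/-- Jensen's inequality for `-x log x` and countable mixtures. -/
lemma tsum_mul_pointEntropy_le {ι : Type*} (w a : ι → ℝ≥0∞) (hw : ∑' i, w i = 1)
    (ha : ∀ i, a i ≤ 1) :
    ∑' i, w i * pointEntropy (a i) ≤ pointEntropy (∑' i, w i * a i) := by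
  set x := ∑' i, w i * a i with hx
  have hx1 : x ≤ 1 := by
    rw [← hw]
    exact ENNReal.tsum_le_tsum fun i => mul_le_of_le_one_right' (ha i)
  have hxt : x ≠ ∞ := ne_top_of_le_ne_top ENNReal.one_ne_top hx1
  rcases eq_or_ne x 0 with h0 | h0
  · have h := ENNReal.tsum_eq_zero.1 (hx.symm.trans h0)
    refine le_of_eq_of_le (ENNReal.tsum_eq_zero.2 fun i => ?_) zero_le
    rcases mul_eq_zero.1 (h i) with h | h <;> simp [h]
  -- Average the tangent inequality at the mean `x`; the linear terms on both sides average to `x`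
  -- and cancel.
  · have key : ∑' i, w i * (pointEntropy (a i) + a i)
        ≤ ∑' i, w i * (a i * surprisal x + x) :=
      ENNReal.tsum_le_tsum fun i => mul_le_mul_right (pointEntropy_add_le h0 hx1 (ha i)) _
    simp only [mul_add, ← mul_assoc] at key
    rw [ENNReal.tsum_add, ENNReal.tsum_add, ENNReal.tsum_mul_right, ENNReal.tsum_mul_right, hw,
      one_mul, ← hx, ← pointEntropy_eq_mul hxt] at key
    exact (ENNReal.add_le_add_iff_right hxt).1 key

/-- For real numbers this is an equality; only an inequality survives the truncation at `0`, since
masses above `1` give negative terms. -/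
lemma pointEntropy_mul_le {w p : ℝ≥0∞} (hw : w ≠ ∞) (hp : p ≠ ∞) :
    pointEntropy (w * p) ≤ w * pointEntropy p + p * pointEntropy w := by
  have : Real.negMulLog (w * p).toReal
      = w.toReal * Real.negMulLog p.toReal + p.toReal * Real.negMulLog w.toReal := by
    rw [ENNReal.toReal_mul, Real.negMulLog_mul, add_comm]
  rw [pointEntropy, this]
  refine ENNReal.ofReal_add_le.trans_eq ?_
  rw [ENNReal.ofReal_mul ENNReal.toReal_nonneg, ENNReal.ofReal_mul ENNReal.toReal_nonneg,
    ENNReal.ofReal_toReal hw, ENNReal.ofReal_toReal hp, pointEntropy, pointEntropy]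

/-- The entropy of a mixture is at most the entropy of the weights plus the mean entropy. -/
lemma entropy_mixture_le {ι α : Type*} (w : ι → ℝ≥0∞) (p : ι → α → ℝ≥0∞)
    (hw : ∑' i, w i = 1) (hp : ∀ i, ∑' x, p i x ≤ 1) :
    ∑' x, pointEntropy (∑' i, w i * p i x)
      ≤ ∑' i, pointEntropy (w i) + ∑' i, w i * ∑' x, pointEntropy (p i x) := by
  have hp1 (i x) : p i x ≤ 1 := (ENNReal.le_tsum x).trans (hp i)
  have hpt (i x) : p i x ≠ ∞ := ne_top_of_le_ne_top ENNReal.one_ne_top (hp1 i x)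
  have hwt (i) : w i ≠ ∞ :=
    ne_top_of_le_ne_top ENNReal.one_ne_top ((ENNReal.le_tsum i).trans hw.le)
  have hs (x) : ∑' i, w i * p i x ≠ ∞ := by
    refine ne_top_of_le_ne_top ENNReal.one_ne_top (le_trans ?_ hw.le)
    exact ENNReal.tsum_le_tsum fun i => mul_le_of_le_one_right' (hp1 i x)
  calc ∑' x, pointEntropy (∑' i, w i * p i x)
      ≤ ∑' x, ∑' i, (w i * pointEntropy (p i x) + p i x * pointEntropy (w i)) :=
        ENNReal.tsum_le_tsum fun x => (pointEntropy_tsum_le _ (hs x)).trans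
          (ENNReal.tsum_le_tsum fun i => pointEntropy_mul_le (hwt i) (hpt i x))
    _ = ∑' i, (w i * ∑' x, pointEntropy (p i x) + (∑' x, p i x) * pointEntropy (w i)) := by
        rw [ENNReal.tsum_comm]
        refine tsum_congr fun i => ?_
        rw [ENNReal.tsum_add, ENNReal.tsum_mul_left, ENNReal.tsum_mul_right]
    _ ≤ ∑' i, (w i * ∑' x, pointEntropy (p i x) + pointEntropy (w i)) :=
        ENNReal.tsum_le_tsum fun i => add_le_add_right (mul_le_of_le_one_left' (hp i)) _
    _ = _ := by rw [ENNReal.tsum_add, add_comm]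

/-- Splitting a mass `w` into at most `N` parts adds at most `w log N` to the entropy. -/
lemma tsum_pointEntropy_le_of_support {α : Type*} (p : α → ℝ≥0∞) (s : Finset α) {N : ℕ}
    (hN : N ≠ 0) (hs : s.card ≤ N) (hp : ∀ x, x ∉ s → p x = 0) (hp1 : ∑' x, p x ≤ 1) :
    ∑' x, pointEntropy (p x)
      ≤ pointEntropy (∑' x, p x) + (∑' x, p x) * ENNReal.ofReal (Real.log N) := by
  set w := ∑' x, p x with hw
  have hwt : w ≠ ∞ := ne_top_of_le_ne_top ENNReal.one_ne_top hp1
  rcases eq_or_ne w 0 with h0 | h0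
  · have h := ENNReal.tsum_eq_zero.1 (hw.symm.trans h0)
    simp [h]
  have hN0 : (N : ℝ≥0∞) ≠ 0 := by exact_mod_cast hN
  have hN1 : (1 : ℝ≥0∞) ≤ N := by exact_mod_cast Nat.one_le_iff_ne_zero.2 hN
  have hNt : (N : ℝ≥0∞) ≠ ∞ := ENNReal.natCast_ne_top N
  -- The tangent is taken at the mass of each part in the equal split, where the entropy is largest.
  set x := w / N with hx
  have hx0 : x ≠ 0 := ENNReal.div_ne_zero.2 ⟨h0, hNt⟩
  have hx1 : x ≤ 1 := by
    refine ENNReal.div_le_of_le_mul ?_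
    rw [one_mul]
    exact hp1.trans hN1
  have hsum : ∑' y, pointEntropy (p y) = ∑ y ∈ s, pointEntropy (p y) :=
    tsum_eq_sum fun y hy => by simp [hp y hy]
  have hws : w = ∑ y ∈ s, p y := tsum_eq_sum hp
  have hsur : surprisal x ≤ surprisal w + ENNReal.ofReal (Real.log N) := by
    rw [surprisal, surprisal, hx, ENNReal.toReal_div, ENNReal.toReal_natCast,
      Real.log_div (ENNReal.toReal_pos h0 hwt).ne' (by exact_mod_cast hN), neg_sub, sub_eq_add_neg,
      add_comm]
    exact ENNReal.ofReal_add_le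
  have key : ∑ y ∈ s, (pointEntropy (p y) + p y) ≤ ∑ y ∈ s, (p y * surprisal x + x) :=
    Finset.sum_le_sum fun y _ =>
      pointEntropy_add_le hx0 hx1 ((ENNReal.le_tsum y).trans hp1)
  rw [Finset.sum_add_distrib, Finset.sum_add_distrib, ← Finset.sum_mul, ← hws, ← hsum,
    Finset.sum_const, nsmul_eq_mul] at key
  have hcard : (s.card : ℝ≥0∞) * x ≤ w := by
    calc (s.card : ℝ≥0∞) * x ≤ N * x := mul_le_mul_left (by exact_mod_cast hs) _
      _ = w := ENNReal.mul_div_cancel hN0 hNt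
  have h2 := key.trans (add_le_add (mul_le_mul_right hsur w) hcard)
  rw [ENNReal.add_le_add_iff_right hwt, mul_add, ← pointEntropy_eq_mul hwt] at h2
  exact h2

/-- If `q` is at most `N`-to-one on the support of `p`, then passing from `p` to its image under
`q` loses at most `log N` of entropy. -/
lemma entropy_le_of_fiber_card {α β : Type*} (p : α → ℝ≥0∞) (q : α → β) {N : ℕ} (hN : N ≠ 0)
    (hp1 : ∑' x, p x ≤ 1)
    (hq : ∀ b, ∃ s : Finset α, s.card ≤ N ∧ ∀ x, p x ≠ 0 → q x = b → x ∈ s) :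
    ∑' x, pointEntropy (p x)
      ≤ ∑' b, pointEntropy (∑' x : {x // q x = b}, p x) + ENNReal.ofReal (Real.log N) := by
  classical
  have hfib (f : α → ℝ≥0∞) : ∑' x, f x = ∑' b, ∑' x : {x // q x = b}, f x := by
    rw [← (Equiv.sigmaFiberEquiv q).tsum_eq f, ENNReal.tsum_sigma']
    rfl
  have key (b : β) : ∑' x : {x // q x = b}, pointEntropy (p x)
      ≤ pointEntropy (∑' x : {x // q x = b}, p x)
        + (∑' x : {x // q x = b}, p x) * ENNReal.ofReal (Real.log N) := by
    obtain ⟨s, hs, hsp⟩ := hq b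
    refine tsum_pointEntropy_le_of_support (fun x : {x // q x = b} => p x)
      (s.subtype (fun x => q x = b)) hN ?_ ?_ ?_
    · rw [Finset.card_subtype]
      exact (Finset.card_filter_le _ _).trans hs
    · intro x hx
      by_contra h
      exact hx (Finset.mem_subtype.2 (hsp x h x.2))
    · exact (ENNReal.tsum_comp_le_tsum_of_injective Subtype.val_injective p).trans hp1
  rw [hfib]
  refine (ENNReal.tsum_le_tsum key).trans ?_
  rw [ENNReal.tsum_add, ENNReal.tsum_mul_right, ← hfib]
  exact add_le_add_right (mul_le_of_le_one_left' hp1) _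

/-- Entropy is at least the probability of the atoms of mass at most `t`, times `-log t`. -/
lemma tsum_mul_surprisal_le {α : Type*} (p : α → ℝ≥0∞) {t : ℝ≥0∞} (ht : t ≠ ∞) :
    (∑' x : {x // p x ≤ t}, p x) * surprisal t ≤ ∑' x, pointEntropy (p x) := by
  rw [← ENNReal.tsum_mul_right]
  refine le_trans (ENNReal.tsum_le_tsum fun x => ?_)
    (ENNReal.tsum_comp_le_tsum_of_injective
      (Subtype.val_injective (p := fun x => p x ≤ t)) fun x => pointEntropy (p x))
  rw [pointEntropy_eq_mul (ne_top_of_le_ne_top ht x.2)]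
  rcases eq_or_ne (p x) 0 with h0 | h0
  · simp [h0]
  · exact mul_le_mul_right (surprisal_anti h0 x.2 ht) _

/-! ### Quantization cells and the entropy of quantized laws. -/

/-- The integer vector `⌊k x⌋` indexing the quantization cell of `x`. -/
noncomputable def floorVec {ι : Type*} (k : ℕ) (x : ι → ℝ) : ι → ℤ := fun i => ⌊(k : ℝ) * x i⌋

/-- The entropy of the quantization with precision `k` of the law `P`. -/
noncomputable def quantEntropy {ι : Type*} (P : Measure (ι → ℝ)) (k : ℕ) : ℝ≥0∞ :=
  ∑' z : ι → ℤ, pointEntropy (P (floorVec k ⁻¹' {z}))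

lemma measurable_floorVec {ι : Type*} (k : ℕ) : Measurable (floorVec (ι := ι) k) :=
  measurable_pi_lambda _ fun i => by
    have hi : Measurable fun x : ι → ℝ => x i := measurable_pi_apply i
    exact (hi.const_mul (k : ℝ)).floor

lemma tsum_floorVec {ι : Type*} [Fintype ι] (P : Measure (ι → ℝ)) (k : ℕ) (s : Set (ι → ℤ)) :
    ∑' z : s, P (floorVec k ⁻¹' {z.1}) = P (floorVec k ⁻¹' s) :=
  tsum_measure_preimage_singleton s.to_countable fun z _ =>
    measurable_floorVec k (measurableSet_singleton z)

lemma tsum_floorVec_univ {ι : Type*} [Fintype ι] (P : Measure (ι → ℝ)) [IsProbabilityMeasure P]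
    (k : ℕ) : ∑' z, P (floorVec k ⁻¹' {z}) = 1 := by
  rw [← tsum_univ, tsum_floorVec, Set.preimage_univ, measure_univ]

/-- Cells of precision `k` refine the unit cells: integer division by `k` is the coarsening map. -/
lemma floorVec_one_eq {ι : Type*} {k : ℕ} (hk : k ≠ 0) (x : ι → ℝ) :
    floorVec 1 x = fun i => floorVec k x i / (k : ℤ) := by
  funext i
  have hk' : (k : ℝ) ≠ 0 := by exact_mod_cast hk
  simp only [floorVec]
  rw [← Int.floor_div_natCast, mul_div_cancel_left₀ _ hk']
  simp

lemma measurable_quantize {ι : Type*} (k : ℕ) : Measurable (quantize (ι := ι) k) :=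
  measurable_pi_lambda _ fun i =>
    (measurable_from_top (f := fun z : ℤ => (z : ℝ) / k)).comp
      ((measurable_pi_apply i).comp (measurable_floorVec k))

/-- The map `z ↦ z / k` is injective on integer vectors, and points outside its range have no mass.
-/
lemma shannonEntropy_map_quantize {ι : Type*} [Fintype ι] (P : Measure (ι → ℝ)) {k : ℕ}
    (hk : k ≠ 0) : shannonEntropy (P.map (quantize k)) = quantEntropy P k := by
  have hk' : (k : ℝ) ≠ 0 := by exact_mod_cast hk
  let e : (ι → ℤ) → ι → ℝ := fun z i => (z i : ℝ) / k
  have he : Function.Injective e := fun z z' h => funext fun i => by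
    have := congrFun h i
    simp only [e] at this
    exact_mod_cast (div_left_inj' hk').1 this
  have hq (x : ι → ℝ) : quantize k x = e (floorVec k x) := rfl
  have hmass (x : ι → ℝ) : (P.map (quantize k)) {x} = P (quantize k ⁻¹' {x}) :=
    Measure.map_apply (measurable_quantize k) (measurableSet_singleton x)
  unfold shannonEntropy quantEntropy
  rw [← he.tsum_eq]
  · refine tsum_congr fun z => ?_
    have hpre : quantize k ⁻¹' {e z} = floorVec k ⁻¹' {z} := by
      ext x
      simp [hq, he.eq_iff]
    rw [pointEntropy, Measure.real, hmass, hpre]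
  · intro x hx
    by_contra hne
    apply hx
    have : quantize k ⁻¹' {x} = (∅ : Set (ι → ℝ)) := by
      ext y
      simp only [Set.mem_preimage, Set.mem_singleton_iff, Set.mem_empty_iff_false, iff_false, hq]
      exact fun h => hne ⟨_, h⟩
    simp [Measure.real, hmass, this]

lemma quantEntropy_mixture_le {ι D : Type*} [Fintype ι] (P : Measure (ι → ℝ)) (w : D → ℝ≥0∞)
    (Pd : D → Measure (ι → ℝ)) [∀ d, IsProbabilityMeasure (Pd d)] (hw : ∑' d, w d = 1)
    (hP : ∀ s, MeasurableSet s → P s = ∑' d, w d * Pd d s) (k : ℕ) :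
    quantEntropy P k ≤ ∑' d, pointEntropy (w d) + ∑' d, w d * quantEntropy (Pd d) k := by
  have h := entropy_mixture_le w (fun d z => Pd d (floorVec k ⁻¹' {z})) hw
    fun d => (tsum_floorVec_univ (Pd d) k).le
  refine le_of_eq_of_le (tsum_congr fun z => ?_) h
  rw [hP _ (measurable_floorVec k (measurableSet_singleton z))]

lemma le_quantEntropy_mixture {ι D : Type*} [Fintype ι] (P : Measure (ι → ℝ)) (w : D → ℝ≥0∞)
    (Pd : D → Measure (ι → ℝ)) [∀ d, IsProbabilityMeasure (Pd d)] (hw : ∑' d, w d = 1)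
    (hP : ∀ s, MeasurableSet s → P s = ∑' d, w d * Pd d s) (k : ℕ) :
    ∑' d, w d * quantEntropy (Pd d) k ≤ quantEntropy P k := by
  unfold quantEntropy
  simp_rw [← ENNReal.tsum_mul_left]
  rw [ENNReal.tsum_comm]
  refine ENNReal.tsum_le_tsum fun z => ?_
  rw [hP _ (measurable_floorVec k (measurableSet_singleton z))]
  exact tsum_mul_pointEntropy_le w _ hw fun d => prob_le_one

/-- If the points of each unit cube which carry the law lie in at most `N` cells of precision `k`,
the entropy increases by at most `log N` from precision `1` to precision `k`. -/
lemma quantEntropy_le_add_log {ι E : Type*} [Fintype ι] [MeasurableSpace E] (Q : Measure E)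
    [IsProbabilityMeasure Q] {f : E → ι → ℝ} (hf : Measurable f) {k N : ℕ} (hk : k ≠ 0)
    (hN : N ≠ 0) (h : ∀ b, ∃ s : Finset (ι → ℤ), s.card ≤ N ∧
      ∀ x, floorVec 1 (f x) = b → floorVec k (f x) ∈ s) :
    quantEntropy (Q.map f) k ≤ quantEntropy (Q.map f) 1 + ENNReal.ofReal (Real.log N) := by
  have : IsProbabilityMeasure (Q.map f) := Measure.isProbabilityMeasure_map hf.aemeasurable
  let q : (ι → ℤ) → ι → ℤ := fun z i => z i / (k : ℤ)
  have key := entropy_le_of_fiber_card (fun z => (Q.map f) (floorVec k ⁻¹' {z})) q hN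
    (tsum_floorVec_univ _ k).le fun b => by
      obtain ⟨s, hs, hsx⟩ := h b
      refine ⟨s, hs, fun z hz hqz => ?_⟩
      -- A cell of positive mass contains an actual value `f x`, to which `h` applies.
      rw [Measure.map_apply hf (measurable_floorVec k (measurableSet_singleton z))] at hz
      obtain ⟨x, hx⟩ := nonempty_of_measure_ne_zero hz
      have hx' : floorVec k (f x) = z := hx
      rw [← hx']
      refine hsx x ?_
      rw [floorVec_one_eq hk, hx']
      exact hqz
  refine key.trans_eq ?_
  congr 1
  refine tsum_congr fun b => ?_
  congr 1
  refine (tsum_floorVec _ k {z | q z = b}).trans ?_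
  congr 1
  ext x
  simp only [Set.mem_preimage, Set.mem_ofPred_eq, Set.mem_singleton_iff, floorVec_one_eq hk x, q]

/-! ### Lower bound on entropy from absolute continuity. -/

lemma volume_floorVec_preimage {κ : Type*} [Fintype κ] {k : ℕ} (hk : k ≠ 0) (u : κ → ℤ) :
    volume (floorVec k ⁻¹' {u} : Set (κ → ℝ)) = ((k : ℝ≥0∞) ^ Fintype.card κ)⁻¹ := by
  have hk' : (0 : ℝ) < k := by exact_mod_cast Nat.pos_of_ne_zero hk
  have : (floorVec k ⁻¹' {u} : Set (κ → ℝ))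
      = Set.univ.pi fun i => Set.Ico ((u i : ℝ) / k) (((u i : ℝ) + 1) / k) := by
    ext x
    simp only [Set.mem_preimage, Set.mem_singleton_iff, funext_iff, floorVec, Int.floor_eq_iff,
      Set.mem_pi, Set.mem_univ, true_imp_iff, Set.mem_Ico, div_le_iff₀ hk', lt_div_iff₀ hk',
      mul_comm]
  rw [this, volume_pi_pi]
  simp only [Real.volume_Ico]
  have h (i : κ) : ENNReal.ofReal (((u i : ℝ) + 1) / k - u i / k) = (k : ℝ≥0∞)⁻¹ := by
    rw [← sub_div, add_sub_cancel_left, one_div, ENNReal.ofReal_inv_of_pos hk',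
      ENNReal.ofReal_natCast]
  simp only [h, Finset.prod_const, Finset.card_univ, ENNReal.inv_pow]

/-- Absolute continuity of the integral of the Radon–Nikodym density, which is integrable because
`W` is finite. -/
lemma exists_pos_measure_lt_of_absolutelyContinuous {E : Type*} [MeasurableSpace E]
    {W V : Measure E} [IsFiniteMeasure W] [SigmaFinite V] (h : W ≪ V) {ε : ℝ≥0∞} (hε : ε ≠ 0) :
    ∃ δ > 0, ∀ s, V s < δ → W s < ε := by
  obtain ⟨δ, hδ, H⟩ := exists_pos_setLIntegral_lt_of_measure_lt
    (Measure.lintegral_rnDeriv_lt_top W V).ne hε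
  refine ⟨δ, hδ, fun s hs => ?_⟩
  rw [← Measure.setLIntegral_rnDeriv h s]
  exact H s hs

/-- Call a cell heavy if its mass exceeds `t = M k ^ (-r)`, with `r` the number of chosen
coordinates. There are at most `1 / t` heavy cells, and their projections to these coordinates have
total volume at most `k ^ (-r) / t = 1 / M < δ`. So heavy cells carry mass at most `ε`, and the
remaining mass has surprisal at least that of `t`. -/
lemma one_sub_mul_surprisal_le {ι κ E : Type*} [Fintype ι] [Fintype κ] [MeasurableSpace E]
    (Q : Measure E) [IsProbabilityMeasure Q] {f : E → ι → ℝ} (hf : Measurable f) (a : κ → ι)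
    (hac : Q.map (fun x j => f x (a j)) ≪ (volume : Measure (κ → ℝ))) {ε : ℝ≥0∞} (hε : ε ≠ 0) :
    ∃ M : ℕ, M ≠ 0 ∧ ∀ k : ℕ, k ≠ 0 →
      (1 - ε) * surprisal (M * ((k : ℝ≥0∞) ^ Fintype.card κ)⁻¹) ≤ quantEntropy (Q.map f) k := by
  have hP : IsProbabilityMeasure (Q.map f) := Measure.isProbabilityMeasure_map hf.aemeasurable
  have hfa : Measurable fun x j => f x (a j) :=
    measurable_pi_lambda _ fun j => (measurable_pi_apply (a j)).comp hf
  have hW : IsProbabilityMeasure (Q.map fun x j => f x (a j)) :=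
    Measure.isProbabilityMeasure_map hfa.aemeasurable
  obtain ⟨δ, hδ, H⟩ := exists_pos_measure_lt_of_absolutelyContinuous hac hε
  obtain ⟨M, hM⟩ := ENNReal.exists_inv_nat_lt hδ.ne'
  have hM0 : (M : ℝ≥0∞)⁻¹ < δ := hM
  -- Passing to `M + 1` makes the constant nonzero.
  have hMz : (M + 1 : ℕ) ≠ 0 := M.succ_ne_zero
  have hM1 : ((M + 1 : ℕ) : ℝ≥0∞)⁻¹ < δ :=
    lt_of_le_of_lt (ENNReal.inv_le_inv.2 (by exact_mod_cast M.le_succ)) hM0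
  clear hM hM0
  generalize M + 1 = M at hMz hM1
  refine ⟨M, hMz, fun k hk => ?_⟩
  have hMn : (M : ℝ≥0∞) ≠ 0 := by exact_mod_cast hMz
  have hMt : (M : ℝ≥0∞) ≠ ∞ := ENNReal.natCast_ne_top M
  set v : ℝ≥0∞ := ((k : ℝ≥0∞) ^ Fintype.card κ)⁻¹ with hv
  have hvt : v ≠ ∞ := ENNReal.inv_ne_top.2 (pow_ne_zero _ (by exact_mod_cast hk))
  set t : ℝ≥0∞ := M * v with ht
  have htt : t ≠ ∞ := ENNReal.mul_ne_top hMt hvt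
  let p : (ι → ℤ) → ℝ≥0∞ := fun z => (Q.map f) (floorVec k ⁻¹' {z})
  refine le_trans (mul_le_mul_left ?_ _) (tsum_mul_surprisal_le p htt)
  let T : Set (ι → ℤ) := {z | t < p z}
  have hcompl : (floorVec k ⁻¹' {z | p z ≤ t} : Set (ι → ℝ)) = (floorVec k ⁻¹' T)ᶜ := by
    ext x
    simp [T]
  have hTm : MeasurableSet (floorVec k ⁻¹' T : Set (ι → ℝ)) :=
    measurable_floorVec k T.to_countable.measurableSet
  have hsum : ∑' z : {z // p z ≤ t}, p z = 1 - (Q.map f) (floorVec k ⁻¹' T) := by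
    refine (tsum_floorVec (Q.map f) k {z | p z ≤ t}).trans ?_
    rw [hcompl, prob_compl_eq_one_sub hTm]
  rw [hsum]
  refine tsub_le_tsub_left ?_ 1
  let U : Set (κ → ℝ) := ⋃ z : T, floorVec k ⁻¹' {fun j => z.1 (a j)}
  have hUm : MeasurableSet U :=
    MeasurableSet.iUnion fun z => measurable_floorVec k (measurableSet_singleton _)
  have hTt : (∑' _ : T, t) ≤ 1 := calc
    (∑' _ : T, t) ≤ ∑' z : T, p z := ENNReal.tsum_le_tsum fun z => z.2.le
    _ ≤ ∑' z, p z := ENNReal.tsum_comp_le_tsum_of_injective Subtype.val_injective p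
    _ = 1 := tsum_floorVec_univ _ k
  have hU : volume U < δ := by
    refine lt_of_le_of_lt ?_ hM1
    calc volume U ≤ ∑' z : T, volume (floorVec k ⁻¹' {fun j => z.1 (a j)} : Set (κ → ℝ)) :=
          measure_iUnion_le _
      _ = (M : ℝ≥0∞)⁻¹ * ∑' _ : T, t := by
          rw [← ENNReal.tsum_mul_left]
          refine tsum_congr fun z => ?_
          rw [volume_floorVec_preimage hk, ht, ← mul_assoc, ENNReal.inv_mul_cancel hMn hMt, one_mul]
      _ ≤ (M : ℝ≥0∞)⁻¹ := mul_le_of_le_one_right' hTt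
  refine le_trans ?_ (H U hU).le
  rw [Measure.map_apply hf hTm, Measure.map_apply hfa hUm]
  refine measure_mono fun x hx => ?_
  exact Set.mem_iUnion.2 ⟨⟨floorVec k (f x), hx⟩, rfl⟩

lemma tendsto_surprisal_div_log (M r : ℕ) (hM : M ≠ 0) :
    Tendsto (fun k : ℕ => surprisal (M * ((k : ℝ≥0∞) ^ r)⁻¹) / ENNReal.ofReal (Real.log k))
      atTop (𝓝 (r : ℝ≥0∞)) := by
  have hlog : Tendsto (fun k : ℕ => Real.log k) atTop atTop :=
    Real.tendsto_log_atTop.comp tendsto_natCast_atTop_atTop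
  have h1 : Tendsto (fun k : ℕ => (r : ℝ) - Real.log M / Real.log k) atTop (𝓝 r) := by
    simpa using tendsto_const_nhds.sub (hlog.const_div_atTop (Real.log M))
  have h2 := ENNReal.tendsto_ofReal h1
  rw [ENNReal.ofReal_natCast] at h2
  refine h2.congr' ?_
  filter_upwards [hlog.eventually_gt_atTop 0, eventually_gt_atTop 0] with k hk hk0
  rw [surprisal, ← ENNReal.ofReal_div_of_pos hk]
  have hkr : (k : ℝ) ≠ 0 := by exact_mod_cast hk0.ne'
  have hMr : (M : ℝ) ≠ 0 := by exact_mod_cast hM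
  congr 1
  simp only [ENNReal.toReal_mul, ENNReal.toReal_inv, ENNReal.toReal_pow, ENNReal.toReal_natCast]
  rw [Real.log_mul hMr (inv_ne_zero (pow_ne_zero _ hkr)), Real.log_inv, Real.log_pow]
  field_simp
  ring

lemma le_liminf_quantEntropy {ι κ E : Type*} [Fintype ι] [Fintype κ] [MeasurableSpace E]
    (Q : Measure E) [IsProbabilityMeasure Q] {f : E → ι → ℝ} (hf : Measurable f) (a : κ → ι)
    (hac : Q.map (fun x j => f x (a j)) ≪ (volume : Measure (κ → ℝ))) :
    (Fintype.card κ : ℝ≥0∞)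
      ≤ liminf (fun k : ℕ => quantEntropy (Q.map f) k / ENNReal.ofReal (Real.log k)) atTop := by
  have key (ε : ℝ≥0∞) (hε : ε ≠ 0) : (1 - ε) * (Fintype.card κ : ℝ≥0∞)
      ≤ liminf (fun k : ℕ => quantEntropy (Q.map f) k / ENNReal.ofReal (Real.log k)) atTop := by
    obtain ⟨M, hM, H⟩ := one_sub_mul_surprisal_le Q hf a hac hε
    have hlim := ENNReal.Tendsto.const_mul (a := 1 - ε)
      (tendsto_surprisal_div_log M (Fintype.card κ) hM)
      (Or.inr (ne_top_of_le_ne_top ENNReal.one_ne_top tsub_le_self))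
    rw [← hlim.liminf_eq]
    refine liminf_le_liminf ?_
    filter_upwards [eventually_ne_atTop 0] with k hk
    rw [← mul_div_assoc]
    exact ENNReal.div_le_div_right (H k hk) _
  have hlim : Tendsto (fun j : ℕ => (1 - (j : ℝ≥0∞)⁻¹) * (Fintype.card κ : ℝ≥0∞)) atTop
      (𝓝 ((1 - 0) * (Fintype.card κ : ℝ≥0∞))) := by
    refine ENNReal.Tendsto.mul_const ?_ (Or.inr (ENNReal.natCast_ne_top _))
    exact ENNReal.Tendsto.sub tendsto_const_nhds ENNReal.tendsto_inv_nat_nhds_zero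
      (Or.inl ENNReal.one_ne_top)
  rw [tsub_zero, one_mul] at hlim
  -- Take `ε = 1 / j`; at `j = 0` this is `∞` and the bound reads `0 ≤ _`.
  exact le_of_tendsto' hlim fun j => key _ (ENNReal.inv_ne_zero.2 (ENNReal.natCast_ne_top j))

/-! ### Affine images: entropy growth is governed by the rank. -/

/-- Some rows `a` of `M` form a basis of the row space, and `L` expresses every row in them. -/
lemma exists_row_basis {m n : ℕ} (M : Matrix (Fin m) (Fin n) ℝ) :
    ∃ (r : ℕ) (a : Fin r → Fin m) (L : Matrix (Fin m) (Fin r) ℝ), r = M.rank ∧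
      M = L * M.submatrix a id ∧ Function.Surjective (M.submatrix a id).mulVec := by
  obtain ⟨κ, a, ha, hspan, hli⟩ := exists_linearIndependent' ℝ M.row
  have : Finite κ := Finite.of_injective a ha
  have : Fintype κ := Fintype.ofFinite κ
  have hcard : Fintype.card κ = M.rank := by
    rw [Matrix.rank_eq_finrank_span_row, ← hspan, finrank_span_eq_card hli]
  let e := Fintype.equivFin κ
  have hrange : Set.range (M.row ∘ (a ∘ e.symm)) = Set.range (M.row ∘ a) := by
    rw [← Function.comp_assoc, e.symm.surjective.range_comp]
  have hmem (i : Fin m) : M.row i ∈ Submodule.span ℝ (Set.range (M.row ∘ (a ∘ e.symm))) := by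
    rw [hrange, hspan]
    exact Submodule.subset_span ⟨i, rfl⟩
  choose L hL using fun i => (Submodule.mem_span_range_iff_exists_fun ℝ).1 (hmem i)
  refine ⟨Fintype.card κ, a ∘ e.symm, Matrix.of L, hcard, ?_, ?_⟩
  · ext i j
    have := congrFun (hL i) j
    rw [Finset.sum_apply] at this
    rw [Matrix.mul_apply]
    exact this.symm
  · have hli' : LinearIndependent ℝ (M.submatrix (a ∘ e.symm) id).row :=
      hli.comp e.symm e.symm.injective
    have hr := hli'.rank_matrix
    have htop : LinearMap.range (M.submatrix (a ∘ e.symm) id).mulVecLin = ⊤ := by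
      apply Submodule.eq_top_of_finrank_eq
      rw [← Matrix.rank, hr, Module.finrank_fintype_fun_eq_card]
    exact LinearMap.range_eq_top.1 htop

/-- A linear surjection sends Lebesgue measure to a multiple of Lebesgue measure. The factor may be
infinite, which does no harm to absolute continuity. -/
lemma map_affine_absolutelyContinuous {n r : ℕ} (Q : Measure (Fin n → ℝ)) (hQ : Q ≪ volume)
    (B : Matrix (Fin r) (Fin n) ℝ) (hB : Function.Surjective B.mulVec) (c : Fin r → ℝ) :
    Q.map (fun x => B *ᵥ x + c) ≪ (volume : Measure (Fin r → ℝ)) := by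
  have hBm : Measurable B.mulVecLin := B.mulVecLin.continuous_of_finiteDimensional.measurable
  have hcm : Measurable fun y : Fin r → ℝ => y + c := measurable_id.add_const c
  have h1 : (fun x => B *ᵥ x + c) = (fun y => y + c) ∘ B.mulVecLin := rfl
  rw [h1, ← Measure.map_map hcm hBm]
  obtain ⟨b, -, hb⟩ := LinearMap.exists_map_addHaar_eq_smul_addHaar (L := B.mulVecLin)
    (volume : Measure (Fin n → ℝ)) (volume : Measure (Fin r → ℝ)) hB
  have h2 : Q.map B.mulVecLin ≪ (volume : Measure (Fin r → ℝ)) := by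
    refine (hQ.map hBm).trans ?_
    rw [hb]
    exact Measure.smul_absolutelyContinuous
  refine (h2.map hcm).trans ?_
  rw [map_add_right_eq_self]

lemma measurable_affine {m n : ℕ} (M : Matrix (Fin m) (Fin n) ℝ) (c : Fin m → ℝ) :
    Measurable fun x : Fin n → ℝ => M *ᵥ x + c :=
  (M.mulVecLin.continuous_of_finiteDimensional.measurable).add_const c

lemma rank_le_liminf_quantEntropy {m n : ℕ} (M : Matrix (Fin m) (Fin n) ℝ) (c : Fin m → ℝ)
    (Q : Measure (Fin n → ℝ)) [IsProbabilityMeasure Q] (hQ : Q ≪ volume) :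
    (M.rank : ℝ≥0∞) ≤ liminf (fun k : ℕ =>
      quantEntropy (Q.map fun x => M *ᵥ x + c) k / ENNReal.ofReal (Real.log k)) atTop := by
  obtain ⟨r, a, L, hr, -, hsurj⟩ := exists_row_basis M
  have h := le_liminf_quantEntropy Q (measurable_affine M c) a
    (map_affine_absolutelyContinuous Q hQ (M.submatrix a id) hsurj (c ∘ a))
  rwa [Fintype.card_fin, hr] at h

/-- An affine image of rank `r` of `ℝⁿ` meets, in each unit cube, at most a constant times `k ^ r`
cells of precision `k`. -/
lemma exists_card_cells_le {m n : ℕ} (M : Matrix (Fin m) (Fin n) ℝ) :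
    ∃ C : ℕ, C ≠ 0 ∧ ∀ (c : Fin m → ℝ) (k : ℕ) (b : Fin m → ℤ), k ≠ 0 →
      ∃ s : Finset (Fin m → ℤ), s.card ≤ k ^ M.rank * C ∧
        ∀ x, floorVec 1 (M *ᵥ x + c) = b → floorVec k (M *ᵥ x + c) ∈ s := by
  classical
  obtain ⟨r, a, L, hr, hL, -⟩ := exists_row_basis M
  obtain ⟨K, hK⟩ := Finite.exists_le fun i : Fin m => ⌈∑ j, |L i j|⌉₊
  have hK' (i : Fin m) : ∑ j, |L i j| ≤ K :=
    (Nat.le_ceil _).trans (by exact_mod_cast hK i)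
  -- The basis rows have `k` possible cell indices each within a unit cube. They predict every other
  -- coordinate of `k Z` up to `K`, a bound for the absolute row sums of `L`, so each floor is off
  -- by an integer in `[-(K + 1), K + 1]`: `2 K + 3` values.
  refine ⟨(2 * K + 3) ^ m, pow_ne_zero _ (by omega), fun c k b hk => ?_⟩
  have hk' : (0 : ℝ) < k := by exact_mod_cast Nat.pos_of_ne_zero hk
  -- The row relation for `M *ᵥ x` becomes affine for `M *ᵥ x + c`, with this defect.
  let d : Fin m → ℝ := fun i => c i - ∑ j, L i j * c (a j)
  let g : (Fin r → ℤ) → Fin m → ℝ := fun u i => ∑ j, L i j * u j + k * d i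
  let s₁ : Finset (Fin r → ℤ) :=
    Fintype.piFinset fun j => Finset.Ico ((k : ℤ) * b (a j)) (k * b (a j) + k)
  let s₂ : Finset (Fin m → ℤ) :=
    Fintype.piFinset fun _ => Finset.Icc (-(K + 1 : ℤ)) (K + 1)
  refine ⟨(s₁ ×ˢ s₂).image fun ue i => ⌊g ue.1 i⌋ + ue.2 i, ?_, fun x hx => ?_⟩
  · refine Finset.card_image_le.trans_eq ?_
    rw [Finset.card_product, Fintype.card_piFinset, Fintype.card_piFinset, ← hr]
    congr 1
    · simp
    · simp only [Int.card_Icc, Finset.prod_const, Finset.card_univ, Fintype.card_fin]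
      congr 1
      omega
  set Z := M *ᵥ x + c with hZ
  have hZL (i : Fin m) : Z i = ∑ j, L i j * Z (a j) + d i := by
    have h1 : M *ᵥ x = L *ᵥ (M.submatrix a id *ᵥ x) := by
      rw [Matrix.mulVec_mulVec, ← hL]
    have h2 : (M *ᵥ x) i = ∑ j, L i j * (M *ᵥ x) (a j) := congrFun h1 i
    simp only [hZ, Pi.add_apply, d, mul_add, Finset.sum_add_distrib]
    linarith
  let u : Fin r → ℤ := fun j => floorVec k Z (a j)
  refine Finset.mem_image.2 ⟨(u, fun i => floorVec k Z i - ⌊g u i⌋), ?_, ?_⟩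
  · refine Finset.mem_product.2 ⟨Fintype.mem_piFinset.2 fun j => ?_,
      Fintype.mem_piFinset.2 fun i => ?_⟩
    · have h1 : ⌊((1 : ℕ) : ℝ) * Z (a j)⌋ = b (a j) := congrFun hx (a j)
      rw [Nat.cast_one, one_mul, Int.floor_eq_iff] at h1
      rw [Finset.mem_Ico]
      constructor
      · refine Int.le_floor.2 ?_
        push_cast
        exact mul_le_mul_of_nonneg_left h1.1 hk'.le
      · refine Int.floor_lt.2 ?_
        push_cast
        have := mul_lt_mul_of_pos_left h1.2 hk'
        linarith
    · have hdiff : k * Z i - g u i = ∑ j, L i j * (k * Z (a j) - u j) := by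
        have h3 : (k : ℝ) * ∑ j, L i j * Z (a j) = ∑ j, L i j * (k * Z (a j)) := by
          rw [Finset.mul_sum]
          exact Finset.sum_congr rfl fun j _ => by ring
        rw [hZL i, mul_add, h3]
        simp only [g, mul_sub, Finset.sum_sub_distrib]
        ring
      have hab : |k * Z i - g u i| ≤ K := by
        rw [hdiff]
        refine (Finset.abs_sum_le_sum_abs _ _).trans (le_trans ?_ (hK' i))
        refine Finset.sum_le_sum fun j _ => ?_
        rw [abs_mul]
        refine mul_le_of_le_one_right (abs_nonneg _) ?_
        have h1 := Int.floor_le ((k : ℝ) * Z (a j))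
        have h2 := Int.lt_floor_add_one ((k : ℝ) * Z (a j))
        rw [abs_le]
        constructor <;> simp only [u, floorVec] <;> linarith
      rw [abs_le] at hab
      have h1 := Int.floor_le ((k : ℝ) * Z i)
      have h2 := Int.lt_floor_add_one ((k : ℝ) * Z i)
      have h3 := Int.floor_le (g u i)
      have h4 := Int.lt_floor_add_one (g u i)
      rw [Finset.mem_Icc]
      simp only [floorVec]
      constructor
      · have : (-(K + 1 : ℤ) : ℝ) ≤ ((⌊(k : ℝ) * Z i⌋ - ⌊g u i⌋ : ℤ) : ℝ) := by
          push_cast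
          linarith
        exact_mod_cast this
      · have : ((⌊(k : ℝ) * Z i⌋ - ⌊g u i⌋ : ℤ) : ℝ) ≤ ((K + 1 : ℤ) : ℝ) := by
          push_cast
          linarith
        exact_mod_cast this
  · funext i
    simp

lemma exists_quantEntropy_affine_le {m n : ℕ} (M : Matrix (Fin m) (Fin n) ℝ) :
    ∃ C : ℕ, ∀ (c : Fin m → ℝ) (Q : Measure (Fin n → ℝ)) [IsProbabilityMeasure Q] (k : ℕ),
      k ≠ 0 → quantEntropy (Q.map fun x => M *ᵥ x + c) k
        ≤ quantEntropy (Q.map fun x => M *ᵥ x + c) 1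
          + (C + M.rank * ENNReal.ofReal (Real.log k)) := by
  obtain ⟨C, hC, H⟩ := exists_card_cells_le M
  refine ⟨⌈Real.log C⌉₊, fun c Q _ k hk => ?_⟩
  have hN : k ^ M.rank * C ≠ 0 := mul_ne_zero (pow_ne_zero _ hk) hC
  refine (quantEntropy_le_add_log Q (measurable_affine M c) hk hN fun b => H c k b hk).trans ?_
  refine add_le_add_right ?_ _
  have hk' : (k : ℝ) ≠ 0 := by exact_mod_cast hk
  have hC' : (C : ℝ) ≠ 0 := by exact_mod_cast hC
  rw [Nat.cast_mul, Nat.cast_pow, Real.log_mul (pow_ne_zero _ hk') hC', Real.log_pow, add_comm]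
  refine ENNReal.ofReal_add_le.trans (add_le_add ?_ ?_)
  · exact (ENNReal.ofReal_le_ofReal (Nat.le_ceil _)).trans_eq (ENNReal.ofReal_natCast _)
  · rw [ENNReal.ofReal_mul (Nat.cast_nonneg _), ENNReal.ofReal_natCast]

/-! ### Information dimension of countable mixtures. -/

/-- Fatou's lemma for the counting measure. -/
lemma tsum_liminf_le {D : Type*} [Countable D] (f : ℕ → D → ℝ≥0∞) :
    ∑' d, liminf (fun k => f k d) atTop ≤ liminf (fun k => ∑' d, f k d) atTop := by
  let : MeasurableSpace D := ⊤
  have h := lintegral_liminf_le (μ := Measure.count) (u := atTop) (f := f)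
    fun _ => measurable_from_top
  rw [lintegral_count' measurable_from_top] at h
  simpa only [lintegral_count' measurable_from_top] using h

/-- A countable mixture, with weights of finite entropy, of laws `Pd d` of information dimension
`r d` has information dimension `∑ w d * r d`, provided that the growth of the entropies is
controlled uniformly. -/
lemma hasRenyiDim_mixture {ι D : Type*} [Fintype ι] [Countable D] (P : Measure (ι → ℝ))
    (w : D → ℝ≥0∞) (Pd : D → Measure (ι → ℝ)) [∀ d, IsProbabilityMeasure (Pd d)]
    (hw : ∑' d, w d = 1) (hP : ∀ s, MeasurableSet s → P s = ∑' d, w d * Pd d s)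
    (hwH : ∑' d, pointEntropy (w d) ≠ ∞) (hP1 : quantEntropy P 1 ≠ ∞) (r : D → ℝ≥0∞) (C : ℕ)
    (hupper : ∀ d k, k ≠ 0 → quantEntropy (Pd d) k
      ≤ quantEntropy (Pd d) 1 + (C + r d * ENNReal.ofReal (Real.log k)))
    (hlower : ∀ d, r d ≤ liminf (fun k : ℕ =>
      quantEntropy (Pd d) k / ENNReal.ofReal (Real.log k)) atTop) :
    HasRenyiDim P (∑' d, w d * r d) := by
  have hlog : Tendsto (fun k : ℕ => ENNReal.ofReal (Real.log k)) atTop (𝓝 ∞) :=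
    ENNReal.tendsto_ofReal_atTop.comp
      (Real.tendsto_log_atTop.comp tendsto_natCast_atTop_atTop)
  have hlim : Tendsto (fun k : ℕ => quantEntropy P k / ENNReal.ofReal (Real.log k)) atTop
      (𝓝 (∑' d, w d * r d)) := by
    refine tendsto_of_le_liminf_of_limsup_le ?_ ?_
    · calc ∑' d, w d * r d
          ≤ ∑' d, liminf (fun k : ℕ =>
              w d * (quantEntropy (Pd d) k / ENNReal.ofReal (Real.log k))) atTop := by
            refine ENNReal.tsum_le_tsum fun d => ?_
            have hd : w d ≠ ∞ :=
              ne_top_of_le_ne_top ENNReal.one_ne_top ((ENNReal.le_tsum d).trans hw.le)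
            rw [ENNReal.liminf_const_mul_of_ne_top hd]
            exact mul_le_mul_right (hlower d) _
        _ ≤ liminf (fun k : ℕ =>
              ∑' d, w d * (quantEntropy (Pd d) k / ENNReal.ofReal (Real.log k))) atTop :=
            tsum_liminf_le _
        _ ≤ _ := by
            refine liminf_le_liminf (Eventually.of_forall fun k => ?_)
            simp only [div_eq_mul_inv, ← mul_assoc]
            rw [ENNReal.tsum_mul_right]
            exact mul_le_mul_left (le_quantEntropy_mixture P w Pd hw hP k) _
    -- `K` collects everything that stays bounded in `k`, so `K / log k` tends to `0`.
    · set K := ∑' d, pointEntropy (w d) + quantEntropy P 1 + C with hK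
      have hKt : K ≠ ∞ :=
        ENNReal.add_ne_top.2 ⟨ENNReal.add_ne_top.2 ⟨hwH, hP1⟩, ENNReal.natCast_ne_top C⟩
      have hbound : Tendsto (fun k : ℕ => K / ENNReal.ofReal (Real.log k) + ∑' d, w d * r d) atTop
          (𝓝 (∑' d, w d * r d)) := by
        have h0 := ENNReal.Tendsto.const_div (a := K) hlog (Or.inr hKt)
        rw [ENNReal.div_top] at h0
        simpa using h0.add_const (∑' d, w d * r d)
      rw [← hbound.limsup_eq]
      refine limsup_le_limsup ?_
      filter_upwards [hlog.eventually (lt_mem_nhds ENNReal.zero_lt_top), eventually_ne_atTop 0]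
        with k hk hk0
      have h1 : quantEntropy P k ≤ K + (∑' d, w d * r d) * ENNReal.ofReal (Real.log k) := calc
        quantEntropy P k
            ≤ ∑' d, pointEntropy (w d) + ∑' d, w d * quantEntropy (Pd d) k :=
              quantEntropy_mixture_le P w Pd hw hP k
        _ ≤ ∑' d, pointEntropy (w d) + ∑' d, w d *
              (quantEntropy (Pd d) 1 + (C + r d * ENNReal.ofReal (Real.log k))) :=
              add_le_add_right (ENNReal.tsum_le_tsum fun d =>
                mul_le_mul_right (hupper d k hk0) _) _
        _ = ∑' d, pointEntropy (w d) + (∑' d, w d * quantEntropy (Pd d) 1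
              + (C + (∑' d, w d * r d) * ENNReal.ofReal (Real.log k))) := by
              simp only [mul_add, ← mul_assoc]
              rw [ENNReal.tsum_add, ENNReal.tsum_add, ENNReal.tsum_mul_right,
                ENNReal.tsum_mul_right, hw, one_mul]
        -- No uniform bound on the components at precision `1` is needed: by concavity their mean
        -- entropy is at most that of `P`, which is finite.
        _ ≤ ∑' d, pointEntropy (w d) + (quantEntropy P 1
              + (C + (∑' d, w d * r d) * ENNReal.ofReal (Real.log k))) :=
              add_le_add_right (add_le_add_left (le_quantEntropy_mixture P w Pd hw hP 1) _) _
        _ = K + (∑' d, w d * r d) * ENNReal.ofReal (Real.log k) := by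
              rw [hK, add_assoc, add_assoc]
      refine (ENNReal.div_le_div_right h1 _).trans_eq ?_
      rw [ENNReal.add_div, ENNReal.mul_div_cancel_right hk.ne' ENNReal.ofReal_ne_top]
  refine hlim.congr' ?_
  filter_upwards [eventually_ne_atTop 0] with k hk
  rw [shannonEntropy_map_quantize P hk]

/-! ### The law of `A X` as a mixture over the discrete data. -/

/-- The matrix `A` with the columns outside `ν` replaced by `0`. -/
def maskCols {m n : ℕ} (A : Matrix (Fin m) (Fin n) ℝ) (ν : Fin n → Bool) :
    Matrix (Fin m) (Fin n) ℝ := Matrix.of fun i j => A i j * bit (ν j)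

/-- Zero columns do not change the column span. Masking rather than deleting columns keeps the
domain `ℝⁿ` fixed, so that the joint law of `Xc` can be used for every `ν`. -/
lemma rank_maskCols {m n : ℕ} (A : Matrix (Fin m) (Fin n) ℝ) (ν : Fin n → Bool) :
    (maskCols A ν).rank = (selectCols A ν).rank := by
  rw [Matrix.rank_eq_finrank_span_cols, Matrix.rank_eq_finrank_span_cols]
  have h : Submodule.span ℝ (Set.range (maskCols A ν).col)
      = Submodule.span ℝ (Set.range (selectCols A ν).col) := by
    refine le_antisymm (Submodule.span_le.2 ?_) (Submodule.span_le.2 ?_)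
    · rintro _ ⟨j, rfl⟩
      by_cases hj : ν j = true
      · refine Submodule.subset_span ⟨⟨j, hj⟩, ?_⟩
        funext i
        simp [maskCols, selectCols, bit, hj, Matrix.col]
      · have : (maskCols A ν).col j = 0 := by
          funext i
          simp [maskCols, bit, hj, Matrix.col]
        rw [this]
        exact Submodule.zero_mem _
    · rintro _ ⟨⟨j, hj⟩, rfl⟩
      refine Submodule.subset_span ⟨j, ?_⟩
      funext i
      simp [maskCols, selectCols, bit, hj, Matrix.col]
  rw [h]

/-- For fixed discrete data this is affine in the continuous part, with a shift given by the
discrete data. -/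
lemma mulVec_mix {m n : ℕ} (A : Matrix (Fin m) (Fin n) ℝ) (ν : Fin n → Bool) (x y : Fin n → ℝ) :
    A *ᵥ mix ν x y = maskCols A ν *ᵥ x + A *ᵥ fun j => (1 - bit (ν j)) * y j := by
  funext i
  simp only [Matrix.mulVec, dotProduct, mix, maskCols, Matrix.of_apply, Pi.add_apply]
  rw [← Finset.sum_add_distrib]
  exact Finset.sum_congr rfl fun j _ => by ring

lemma measurable_mix {n : ℕ} :
    Measurable fun p : (Fin n → ℝ) × ((Fin n → Bool) × (Fin n → ℝ)) => mix p.2.1 p.1 p.2.2 := by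
  refine measurable_pi_lambda _ fun i => ?_
  have hb : Measurable fun p : (Fin n → ℝ) × ((Fin n → Bool) × (Fin n → ℝ)) => bit (p.2.1 i) :=
    (measurable_from_top (f := bit)).comp
      ((measurable_pi_apply i).comp (measurable_fst.comp measurable_snd))
  have hx : Measurable fun p : (Fin n → ℝ) × ((Fin n → Bool) × (Fin n → ℝ)) => p.1 i :=
    (measurable_pi_apply i).comp measurable_fst
  have hy : Measurable fun p : (Fin n → ℝ) × ((Fin n → Bool) × (Fin n → ℝ)) => p.2.2 i :=
    (measurable_pi_apply i).comp (measurable_snd.comp measurable_snd)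
  exact (hb.mul hx).add ((measurable_const.sub hb).mul hy)

lemma measurable_mulVec {m n : ℕ} (A : Matrix (Fin m) (Fin n) ℝ) :
    Measurable fun x : Fin n → ℝ => A *ᵥ x :=
  A.mulVecLin.continuous_of_finiteDimensional.measurable

/-- A vector of a finite variable and finitely many discrete variables has a discrete law. -/
lemma exists_countable_ae_mem {B : Type*} [MeasurableSpace B] [Finite B] {n : ℕ} {Ω : Type*}
    [MeasurableSpace Ω] (μ : Measure Ω) {ν : Ω → B} {Y : Ω → Fin n → ℝ}
    (hν : Measurable ν) (hY : Measurable Y)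
    (hdisc : ∀ i, IsDiscreteLaw (μ.map fun ω => Y ω i)) :
    ∃ S : Set (B × (Fin n → ℝ)), S.Countable ∧ ∀ᵐ d ∂(μ.map fun ω => (ν ω, Y ω)), d ∈ S := by
  choose T hT hT0 using hdisc
  have hc : (Set.univ.pi T).Countable := Set.countable_univ_pi hT
  have hS : (Set.univ ×ˢ Set.univ.pi T : Set (B × (Fin n → ℝ))).Countable :=
    Set.countable_univ.prod hc
  refine ⟨_, hS, ?_⟩
  have hSm : MeasurableSet (Set.univ ×ˢ Set.univ.pi T : Set (B × (Fin n → ℝ))) :=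
    MeasurableSet.univ.prod hc.measurableSet
  refine (ae_map_iff (p := fun d => d ∈ Set.univ ×ˢ Set.univ.pi T) (hν.prodMk hY).aemeasurable hSm).2 ?_
  have h : ∀ᵐ ω ∂μ, ∀ i, Y ω i ∈ T i := by
    refine ae_all_iff.2 fun i => ?_
    have hi : Measurable fun ω => Y ω i := (measurable_pi_apply i).comp hY
    exact (ae_map_iff hi.aemeasurable (hT i).measurableSet).1 (mem_ae_iff.2 (hT0 i))
  filter_upwards [h] with ω hω
  exact ⟨Set.mem_univ _, fun i _ => hω i⟩

end InfoDim

theorem mainTheorem1 {m n : ℕ} {Ω Ω' : Type*} [MeasurableSpace Ω] [MeasurableSpace Ω']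
    (μ : Measure Ω) [IsProbabilityMeasure μ] (μ' : Measure Ω') [IsProbabilityMeasure μ']
    (ν : Ω → Fin n → Bool) (Xc Xd : Ω → Fin n → ℝ) (X : Ω' → Fin n → ℝ)
    (hν : Measurable ν) (hXc : Measurable Xc) (hXd : Measurable Xd)
    -- the continuous parts are jointly absolutely continuous, the discrete parts are discrete
    (hcont : μ.map Xc ≪ (volume : Measure (Fin n → ℝ)))
    (hdisc : ∀ i, InfoDim.IsDiscreteLaw (μ.map fun ω => Xd ω i))
    -- the continuous parts are independent of the discrete data
    (hindep : IndepFun Xc (fun ω => (ν ω, Xd ω)) μ)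
    -- the random vector `X` has the law of the mixture
    (hX : IdentDistrib X (fun ω => InfoDim.mix (ν ω) (Xc ω) (Xd ω)) μ' μ)
    (hH : InfoDim.shannonEntropy (μ.map fun ω => (ν ω, Xd ω)) < ∞)
    (A : Matrix (Fin m) (Fin n) ℝ)
    -- the integer part of `A X` has finite entropy
    (hY : InfoDim.shannonEntropy (μ'.map fun ω => InfoDim.quantize 1 (A *ᵥ X ω)) < ∞) :
    InfoDim.HasRenyiDim (μ'.map fun ω => A *ᵥ X ω)
      (∫⁻ ω, ((InfoDim.selectCols A (ν ω)).rank : ℝ≥0∞) ∂μ) := by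
  open InfoDim in
  have hDm : Measurable fun ω => (ν ω, Xd ω) := hν.prodMk hXd
  set ρ := μ.map fun ω => (ν ω, Xd ω) with hρ
  set Q := μ.map Xc with hQ
  have : IsProbabilityMeasure ρ := Measure.isProbabilityMeasure_map hDm.aemeasurable
  have : IsProbabilityMeasure Q := Measure.isProbabilityMeasure_map hXc.aemeasurable
  obtain ⟨S, hS, hSρ⟩ : ∃ S : Set ((Fin n → Bool) × (Fin n → ℝ)), S.Countable ∧
      ∀ᵐ d ∂ρ, d ∈ S := exists_countable_ae_mem μ hν hXd hdisc
  have : Countable S := hS.to_subtype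
  -- As `ρ` is carried by the countable set `S`, integrals against it are sums over atoms.
  have hint (g : (Fin n → Bool) × (Fin n → ℝ) → ℝ≥0∞) :
      ∫⁻ d, g d ∂ρ = ∑' d : S, ρ {d.1} * g d := by
    rw [← Measure.restrict_eq_self_of_ae_mem hSρ, lintegral_countable g hS,
      Measure.restrict_eq_self_of_ae_mem hSρ]
    exact tsum_congr fun d => mul_comm _ _
  have hw : ∑' d : S, ρ {d.1} = 1 := by
    have h1 := hint fun _ => 1
    simpa using h1.symm
  let c (d : (Fin n → Bool) × (Fin n → ℝ)) : Fin m → ℝ := A *ᵥ fun j => (1 - bit (d.1 j)) * d.2 j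
  let Pd (d : S) : Measure (Fin m → ℝ) := Q.map fun x => maskCols A d.1.1 *ᵥ x + c d
  have (d : S) : IsProbabilityMeasure (Pd d) :=
    Measure.isProbabilityMeasure_map (measurable_affine _ _).aemeasurable
  have hAX : AEMeasurable (fun ω => A *ᵥ X ω) μ' :=
    (measurable_mulVec A).comp_aemeasurable hX.aemeasurable_fst
  set P := μ'.map fun ω => A *ᵥ X ω with hP
  have hPmix (s : Set (Fin m → ℝ)) (hs : MeasurableSet s) :
      P s = ∑' d : S, ρ {d.1} * Pd d s := by
    have hG : Measurable fun p : (Fin n → ℝ) × ((Fin n → Bool) × (Fin n → ℝ)) =>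
        A *ᵥ mix p.2.1 p.1 p.2.2 := (measurable_mulVec A).comp measurable_mix
    have hPG : P = (Q.prod ρ).map fun p => A *ᵥ mix p.2.1 p.1 p.2.2 := by
      -- Independence makes the joint law a product; slicing it at each `d` leaves the law `Q`
      -- unconditioned.
      rw [← hindep.map_prod_eq_prod_map_map hXc.aemeasurable hDm.aemeasurable]
      refine (hX.comp (measurable_mulVec A)).map_eq.trans ?_
      exact (Measure.map_map hG (hXc.prodMk hDm)).symm
    rw [hPG, Measure.map_apply hG hs, Measure.prod_apply_symm (hG hs), hint]
    refine tsum_congr fun d => ?_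
    congr 1
    rw [Measure.map_apply (measurable_affine _ _) hs]
    congr 1
    ext x
    simp only [Set.mem_preimage, mulVec_mix, c]
  obtain ⟨C, hC⟩ : ∃ C : ℕ, ∀ (ν' : Fin n → Bool) (c : Fin m → ℝ) (k : ℕ), k ≠ 0 →
      quantEntropy (Q.map fun x => maskCols A ν' *ᵥ x + c) k
        ≤ quantEntropy (Q.map fun x => maskCols A ν' *ᵥ x + c) 1
          + (C + (maskCols A ν').rank * ENNReal.ofReal (Real.log k)) := by
    -- There are finitely many `ν'`, so their constants have a common bound.
    choose C hC using fun ν' : Fin n → Bool => exists_quantEntropy_affine_le (maskCols A ν')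
    obtain ⟨C₀, hC₀⟩ := Finite.exists_le C
    refine ⟨C₀, fun ν' c k hk => (hC ν' c Q k hk).trans ?_⟩
    have : (C ν' : ℝ≥0∞) ≤ C₀ := by exact_mod_cast hC₀ ν'
    gcongr
  have hwH : ∑' d : S, pointEntropy (ρ {d.1}) ≠ ∞ := by
    refine ne_top_of_le_ne_top hH.ne ?_
    exact ENNReal.tsum_comp_le_tsum_of_injective Subtype.val_injective
      fun d => pointEntropy (ρ {d})
  have hP1 : quantEntropy P 1 ≠ ∞ := by
    rw [← shannonEntropy_map_quantize P one_ne_zero, hP,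
      AEMeasurable.map_map_of_aemeasurable (measurable_quantize 1).aemeasurable hAX]
    exact hY.ne
  have hdim : ∫⁻ ω, ((selectCols A (ν ω)).rank : ℝ≥0∞) ∂μ
      = ∑' d : S, ρ {d.1} * ((maskCols A d.1.1).rank : ℝ≥0∞) := by
    have hr : Measurable fun d : (Fin n → Bool) × (Fin n → ℝ) =>
        ((maskCols A d.1).rank : ℝ≥0∞) :=
      (Measurable.of_discrete (f := fun ν' => ((maskCols A ν').rank : ℝ≥0∞))).comp measurable_fst
    rw [← hint fun d => ((maskCols A d.1).rank : ℝ≥0∞), hρ, lintegral_map hr hDm]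
    simp only [rank_maskCols]
  rw [hdim]
  exact hasRenyiDim_mixture P (fun d : S => ρ {d.1}) Pd hw hPmix hwH hP1 _ C
    (fun d k hk => hC d.1.1 (c d) k hk)
    (fun d => rank_le_liminf_quantEntropy (maskCols A d.1.1) (c d) Q hcont)
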